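/- Let $\Lambda$ be an Artin algebra, i.e. an algebra that is finitely generated as a module over a commutative Artinian ring $R$, let $n \ge 0$ be an integer, and let $\Lambda\text{-mod}$ be the category of finitely generated left $\Lambda$-modules. Suppose that $\Lambda$ is $(n+1)$-Gorenstein: the injective dimensions of $\Lambda$ as a left module and as a right module over itself are both finite, and the injective dimension of the left module ${}_\Lambda\Lambda$ equals $n+1$. Then the following are equivalent: 1. $\Lambda$ is a minimal $n$-Auslander-Gorenstein algebra, that is, $\operatorname{id} {}_\Lambda\Lambda \le n+1 \le \operatorname{domdim} \Lambda$; 2. $\operatorname{prinj}(\Lambda) = \{ I \in \Lambda\text{-mod} \mid I \text{ is injective and } \operatorname{Gpd}(\operatorname{soc} I) \le n \}$. Here $\operatorname{prinj}(\Lambda)$ is the class of modules in $\Lambda\text{-mod}$ that are both projective and injective; $\operatorname{soc} I$ is the sum of the simple submodules of $I$; $\operatorname{domdim} \Lambda$ is the supremum in $\{0,1,2,\dots,\infty\}$ of the $t$ such that in the minimal injective coresolution $0 \to {}_\Lambda\Lambda \to I_0 \to I_1 \to \cdots$ the module $I_j$ is projective for all $j < t$; and $\operatorname{Gpd} N$ is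 the least $k$ for which there is an exact sequence $0 \to G_k \to \cdots \to G_0 \to N \to 0$ with all $G_i$ Gorenstein projective ($\infty$ if there is none). A module is Gorenstein projective if it is isomorphic to $\ker d^0$ for an exact complex $(P^i, d^i)_{i \in \mathbb{Z}}$ of finitely generated projective left $\Lambda$-modules that stays exact under $\operatorname{Hom}_\Lambda(-, \Lambda)$. -/

import Mathlib

open CategoryTheory

universe v u

namespace AuslanderGorenstein

/-- The socle of a module: the sum of its simple submodules. -/
def socle (Λ : Type u) [Ring Λ] (M : Type u) [AddCommGroup M] [Module Λ M] : Submodule Λ M :=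
  sSup {S : Submodule Λ M | IsSimpleModule Λ S}

/-- A submodule is essential if it meets every nonzero submodule nontrivially. -/
def IsEssential {Λ : Type u} [Ring Λ] {M : Type u} [AddCommGroup M] [Module Λ M]
    (N : Submodule Λ M) : Prop :=
  ∀ K : Submodule Λ M, N ⊓ K = ⊥ → K = ⊥

/-- A minimal injective coresolution `0 → M → I 0 → I 1 → ⋯` by finitely generated injective
modules: an exact sequence in which `I 0` is an injective envelope of `M` and every `I (j + 1)`
is an injective envelope of the image of `d j`. -/
structure MinimalInjectiveCoresolution (Λ : Type u) [Ring Λ]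
    (M : Type u) [AddCommGroup M] [Module Λ M] where
  I : ℕ → ModuleCat.{u} Λ
  ε : M →ₗ[Λ] I 0
  d : ∀ j : ℕ, I j →ₗ[Λ] I (j + 1)
  finite : ∀ j, Module.Finite Λ (I j)
  injective : ∀ j, Module.Injective Λ (I j)
  ε_injective : Function.Injective ε
  exact_zero : Function.Exact ε (d 0)
  exact_succ : ∀ j, Function.Exact (d j) (d (j + 1))
  essential_ε : IsEssential (LinearMap.range ε)
  essential_d : ∀ j, IsEssential (LinearMap.range (d j))

/-- The dominant dimension of `Λ`: the supremum of the `t` such that, in the minimal injective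
coresolution `0 → Λ → I 0 → I 1 → ⋯` of the left regular module, `I j` is projective for all
`j < t`. -/
noncomputable def dominantDimension (Λ : Type u) [Ring Λ] : ℕ∞ :=
  sSup {t : ℕ∞ | ∃ C : MinimalInjectiveCoresolution Λ Λ,
    ∀ j : ℕ, (j : ℕ∞) < t → Module.Projective Λ (C.I j)}

/-- The injective dimension of the left regular module. The injective dimension of the right
regular module is `selfInjectiveDimension Λᵐᵒᵖ`. -/
noncomputable def selfInjectiveDimension (Λ : Type u) [Ring Λ] : WithBot ℕ∞ :=
  injectiveDimension (ModuleCat.of Λ Λ)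

/-- `Λ` is `m`-Gorenstein: the regular module has finite injective dimension on both sides,
and the injective dimension of the left regular module is `m`. (For Artin algebras the two
injective dimensions then agree.) -/
structure IsGorensteinOfDimension (m : ℕ) (Λ : Type u) [Ring Λ] : Prop where
  left_eq : selfInjectiveDimension Λ = (m : WithBot ℕ∞)
  right_finite : selfInjectiveDimension Λᵐᵒᵖ < ⊤

/-- `Λ` is minimal `n`-Auslander-Gorenstein: `id Λ ≤ n + 1 ≤ domdim Λ`. -/
structure IsMinimalAuslanderGorenstein (n : ℕ) (Λ : Type u) [Ring Λ] : Prop where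
  selfInjectiveDimension_le : selfInjectiveDimension Λ ≤ ((n + 1 : ℕ) : WithBot ℕ∞)
  le_dominantDimension : ((n + 1 : ℕ) : ℕ∞) ≤ dominantDimension Λ

/-- A totally acyclic complex: an exact complex of finitely generated projective modules,
indexed by `ℤ`, which stays exact under `Hom(-, Λ)`. -/
structure TotallyAcyclicComplex (Λ : Type u) [Ring Λ] where
  P : ℤ → ModuleCat.{u} Λ
  d : ∀ i : ℤ, P i →ₗ[Λ] P (i + 1)
  finite : ∀ i, Module.Finite Λ (P i)
  projective : ∀ i, Module.Projective Λ (P i)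
  exact : ∀ i, Function.Exact (d i) (d (i + 1))
  dual_exact : ∀ (i : ℤ) (φ : P (i + 1) →ₗ[Λ] Λ),
    φ ∘ₗ d i = 0 → ∃ ψ : P (i + 1 + 1) →ₗ[Λ] Λ, ψ ∘ₗ d (i + 1) = φ

/-- A (finitely generated) Gorenstein projective module: a module of cocycles of a totally acyclic
complex. -/
def IsGorensteinProjective (Λ : Type u) [Ring Λ] (M : Type u) [AddCommGroup M] [Module Λ M] :
    Prop :=
  ∃ C : TotallyAcyclicComplex Λ, Nonempty (M ≃ₗ[Λ] LinearMap.ker (C.d 0))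

/-- `HasGorensteinResolution Λ k M`: there is an exact sequence
`0 → G k → ⋯ → G 1 → G 0 → M → 0` with all `G i` Gorenstein projective, given by its successive
kernels. -/
def HasGorensteinResolution (Λ : Type u) [Ring Λ] :
    ℕ → ∀ (M : Type u) [AddCommGroup M] [Module Λ M], Prop
  | 0, M, _, _ => IsGorensteinProjective Λ M
  | k + 1, M, _, _ => ∃ (G : ModuleCat.{u} Λ) (f : G →ₗ[Λ] M),
      IsGorensteinProjective Λ G ∧ Function.Surjective f ∧
        HasGorensteinResolution Λ k (LinearMap.ker f)

/-- The Gorenstein projective dimension: the least length of a Gorenstein projective resolution,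
and `⊤` if there is none. -/
noncomputable def gorensteinProjectiveDimension (Λ : Type u) [Ring Λ]
    (M : Type u) [AddCommGroup M] [Module Λ M] : ℕ∞ :=
  sInf {t : ℕ∞ | ∃ k : ℕ, t = k ∧ HasGorensteinResolution Λ k M}

/-- The finitely generated modules that are both projective and injective. -/
def prinj (Λ : Type u) [Ring Λ] : ObjectProperty (ModuleCat.{u} Λ) :=
  fun I => Module.Finite Λ I ∧ Module.Projective Λ I ∧ Module.Injective Λ I

/-- The finitely generated injective modules whose socle has Gorenstein projective dimension at
most `n`. -/
def injWithSocleGpdLE (n : ℕ) (Λ : Type u) [Ring Λ] : ObjectProperty (ModuleCat.{u} Λ) :=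
  fun I => Module.Finite Λ I ∧ Module.Injective Λ I ∧
    gorensteinProjectiveDimension Λ (socle Λ I) ≤ n

end AuslanderGorenstein

/-!
Over an Iwanaga–Gorenstein ring, dualising twice shows that a finitely generated module `M` with
`Ext^i(M, Λ) = 0` for all `i > 0` is Gorenstein projective: it is reflexive, and dualising a
projective resolution of its dual continues a projective resolution of `M` to the right. Hence
`Gpd M ≤ n` if and only if `Ext^i(M, Λ) = 0` for all `i > n`, and, when `id Λ ≤ n + 1`, this
property passes to submodules. Two consequences of this criterion give the theorem.

If the first `n + 1` terms `I 0, …, I n` of the minimal injective coresolution of `Λ` are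
projective and `S` is a simple module with `Gpd S ≤ n`, then `Hom(S, I l) ≠ 0` for some `l ≤ n`,
since otherwise `Ext^i(S, Λ) = 0` for all `i` and `S`, being reflexive, would vanish. So an
injective module whose socle has Gorenstein projective dimension at most `n` embeds into a
projective-injective module, and is therefore projective.

Conversely, the socle of `I j` lies in the kernel of `d j`, a cosyzygy of `Λ`, whose Gorenstein
projective dimension is at most `j` as soon as `I 0, …, I (j - 1)` are projective. By induction on
`j` the terms `I 0, …, I n` are therefore projective.
-/

namespace AuslanderGorenstein

open Abelian

section ExtVanishing

variable {A : Type u} [Ring A] {K P M N X : Type u} [AddCommGroup K] [AddCommGroup P]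
  [AddCommGroup M] [AddCommGroup N] [AddCommGroup X] [Module A K] [Module A P] [Module A M]
  [Module A N] [Module A X]

/-- A short exact sequence `0 → K → P → M → 0` of modules. -/
structure IsShortExact (f : K →ₗ[A] P) (g : P →ₗ[A] M) : Prop where
  injective : Function.Injective f
  exact : Function.Exact f g
  surjective : Function.Surjective g

theorem isShortExact_subtype_ker {g : P →ₗ[A] M} (hg : Function.Surjective g) :
    IsShortExact (LinearMap.ker g).subtype g :=
  ⟨Submodule.subtype_injective _, LinearMap.exact_subtype_ker_map g, hg⟩

theorem isShortExact_mkQ_range {f : K →ₗ[A] P} (hf : Function.Injective f) :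
    IsShortExact f (LinearMap.range f).mkQ :=
  ⟨hf, LinearMap.exact_map_mkQ_range f, Submodule.mkQ_surjective _⟩

theorem isShortExact_rangeRestrict {f : K →ₗ[A] P} {g : P →ₗ[A] N} (hf : Function.Injective f)
    (h : Function.Exact f g) : IsShortExact f g.rangeRestrict :=
  ⟨hf, fun x ↦ by simpa [Subtype.ext_iff] using h x, g.surjective_rangeRestrict⟩

theorem exact_range_subtype {f : K →ₗ[A] P} {g : P →ₗ[A] M} (h : Function.Exact f g) :
    Function.Exact (LinearMap.range f).subtype g :=
  LinearMap.exact_iff.2 <| by rw [h.linearMap_ker_eq, Submodule.range_subtype]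

theorem isShortExact_range_subtype {f : K →ₗ[A] P} {g : P →ₗ[A] N} (h : Function.Exact f g) :
    IsShortExact (LinearMap.range f).subtype g.rangeRestrict :=
  isShortExact_rangeRestrict (Submodule.subtype_injective _) (exact_range_subtype h)

theorem IsShortExact.exists_desc {f : K →ₗ[A] P} {g : P →ₗ[A] M} (h : IsShortExact f g)
    (φ : P →ₗ[A] N) (hφ : φ ∘ₗ f = 0) : ∃ ψ : M →ₗ[A] N, ψ ∘ₗ g = φ := by
  let e := h.exact.linearEquivOfSurjective h.surjective
  refine ⟨(LinearMap.range f).liftQ φ (LinearMap.range_le_ker_iff.2 hφ) ∘ₗ e.symm, ?_⟩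
  ext x
  have : e.symm (g x) = Submodule.Quotient.mk x := (LinearEquiv.symm_apply_eq _).2 rfl
  simp [this]

theorem IsShortExact.shortComplex_shortExact {f : K →ₗ[A] P} {g : P →ₗ[A] M}
    (h : IsShortExact f g) :
    (ShortComplex.mk (ModuleCat.ofHom f) (ModuleCat.ofHom g)
      (by ext x; exact h.exact.apply_apply_eq_zero x)).ShortExact :=
  ModuleCat.shortComplex_shortExact _ h.exact h.injective h.surjective

/-- The vanishing of `Ext^i(M, N)`. -/
def ExtVanishes (A : Type u) [Ring A] (i : ℕ) (M N : Type u) [AddCommGroup M] [AddCommGroup N]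
    [Module A M] [Module A N] : Prop :=
  Subsingleton (Ext (ModuleCat.of A M) (ModuleCat.of A N) i)

theorem extVanishes_zero_iff : ExtVanishes A 0 M N ↔ Subsingleton (M →ₗ[A] N) :=
  (Ext.addEquiv₀.trans ModuleCat.homAddEquiv).toEquiv.subsingleton_congr

theorem extVanishes_of_projective [Module.Projective A M] {i : ℕ} (hi : 0 < i) :
    ExtVanishes A i M N := by
  obtain ⟨i, rfl⟩ := Nat.exists_eq_succ_of_ne_zero hi.ne'
  have : Projective (ModuleCat.of A M) := (IsProjective.iff_projective M).1 inferInstance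
  exact Ext.subsingleton_of_projective _ _ i

theorem extVanishes_of_injective [Module.Injective A N] {i : ℕ} (hi : 0 < i) :
    ExtVanishes A i M N := by
  obtain ⟨i, rfl⟩ := Nat.exists_eq_succ_of_ne_zero hi.ne'
  have := Module.injective_object_of_injective_module A N
  exact Ext.subsingleton_of_injective _ _ i

theorem ExtVanishes.congr_left (e : M ≃ₗ[A] P) {i : ℕ} (h : ExtVanishes A i P N) :
    ExtVanishes A i M N := by
  refine subsingleton_of_forall_eq 0 fun x ↦ ?_
  have hx : (Ext.mk₀ e.toModuleIso.hom).comp ((Ext.mk₀ e.toModuleIso.inv).comp x (zero_add i))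
      (zero_add i) = x := by
    rw [Ext.mk₀_comp_mk₀_assoc, Iso.hom_inv_id, Ext.mk₀_id_comp]
  rw [← hx, h.elim (Ext.comp _ x _) 0, Ext.comp_zero]

namespace IsShortExact

variable {f : K →ₗ[A] P} {g : P →ₗ[A] M} {i : ℕ}

theorem extVanishes_cokernel (h : IsShortExact f g) (hK : ExtVanishes A i K N)
    (hP : ExtVanishes A (i + 1) P N) : ExtVanishes A (i + 1) M N := by
  refine subsingleton_of_forall_eq 0 fun x ↦ ?_
  obtain ⟨y, rfl⟩ := Ext.contravariant_sequence_exact₃ h.shortComplex_shortExact _ x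
    (hP.elim _ _) (add_comm 1 i)
  rw [hK.elim y 0, Ext.comp_zero]

theorem extVanishes_kernel (h : IsShortExact f g) (hP : ExtVanishes A i P N)
    (hM : ExtVanishes A (i + 1) M N) : ExtVanishes A i K N := by
  refine subsingleton_of_forall_eq 0 fun x ↦ ?_
  obtain ⟨y, rfl⟩ := Ext.contravariant_sequence_exact₁ h.shortComplex_shortExact _ x
    (add_comm 1 i) (hM.elim _ _)
  rw [hP.elim y 0, Ext.comp_zero]

theorem extVanishes_into_kernel (h : IsShortExact f g) (hM : ExtVanishes A i X M)
    (hP : ExtVanishes A (i + 1) X P) : ExtVanishes A (i + 1) X K := by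
  refine subsingleton_of_forall_eq 0 fun x ↦ ?_
  obtain ⟨y, rfl⟩ := Ext.covariant_sequence_exact₁ _ h.shortComplex_shortExact x (hP.elim _ _) rfl
  rw [hM.elim y 0, Ext.zero_comp]

theorem exists_extension (h : IsShortExact f g) (hM : ExtVanishes A 1 M N) (φ : K →ₗ[A] N) :
    ∃ ψ : P →ₗ[A] N, ψ ∘ₗ f = φ := by
  obtain ⟨y, hy⟩ := Ext.contravariant_sequence_exact₁ h.shortComplex_shortExact _
    (Ext.mk₀ (ModuleCat.ofHom φ)) (add_zero 1) (hM.elim _ _)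
  obtain ⟨ψ, rfl⟩ := (Ext.mk₀_bijective _ _).surjective y
  rw [Ext.mk₀_comp_mk₀] at hy
  exact ⟨ψ.hom, congrArg ModuleCat.Hom.hom ((Ext.mk₀_bijective _ _).injective hy)⟩

theorem extVanishes_one_of_exists_extension [Module.Projective A P] (h : IsShortExact f g)
    (hext : ∀ φ : K →ₗ[A] N, ∃ ψ : P →ₗ[A] N, ψ ∘ₗ f = φ) : ExtVanishes A 1 M N := by
  refine subsingleton_of_forall_eq 0 fun x ↦ ?_
  obtain ⟨y, rfl⟩ := Ext.contravariant_sequence_exact₃ h.shortComplex_shortExact _ x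
    ((extVanishes_of_projective one_pos).elim _ _) (add_zero 1)
  obtain ⟨φ, rfl⟩ := (Ext.mk₀_bijective _ _).surjective y
  obtain ⟨ψ, hψ⟩ := hext φ.hom
  have hφ : φ = ModuleCat.ofHom f ≫ ModuleCat.ofHom ψ := by ext1; exact hψ.symm
  rw [hφ, ← Ext.mk₀_comp_mk₀]
  exact h.shortComplex_shortExact.extClass_comp_assoc _

end IsShortExact

end ExtVanishing

theorem projective_pi {A : Type*} [Ring A] {ι : Type*} [Finite ι] (Q : ι → Type*)
    [∀ i, AddCommGroup (Q i)] [∀ i, Module A (Q i)] [∀ i, Module.Projective A (Q i)] :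
    Module.Projective A (∀ i, Q i) := by
  classical
  have := Fintype.ofFinite ι
  exact Module.Projective.of_equiv (DFinsupp.linearEquivFunOnFintype (R := A) (M := Q))

section Duality

variable {A B U : Type u} [Ring A] [Ring B] [AddCommGroup U] [Module A U] [Module B U]
  [SMulCommClass A B U] {K P M : Type u} [AddCommGroup K] [AddCommGroup P] [AddCommGroup M]
  [Module A K] [Module A P] [Module A M]

instance projective_hom_free [Module.Projective B U] (n : ℕ) :
    Module.Projective B ((Fin n → A) →ₗ[A] U) :=
  have := projective_pi (A := B) fun _ : Fin n ↦ U
  Module.Projective.of_equiv (LinearEquiv.piRing A U (Fin n) B).symm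

theorem IsShortExact.lcomp {f : K →ₗ[A] P} {g : P →ₗ[A] M} (h : IsShortExact f g)
    (hM : ExtVanishes A 1 M U) :
    IsShortExact (LinearMap.lcomp B U g) (LinearMap.lcomp B U f) where
  injective := LinearMap.lcomp_injective_of_surjective g h.surjective
  exact φ := by
    refine ⟨h.exists_desc φ, ?_⟩
    rintro ⟨ψ, rfl⟩
    rw [LinearMap.lcomp_apply', LinearMap.lcomp_apply', LinearMap.comp_assoc,
      h.exact.linearMap_comp_eq_zero, LinearMap.comp_zero]
  surjective := h.exists_extension hM

/-- `M` is finitely generated and `Ext^i(M, U) = 0` for all `i > 0`, i.e. `M` belongs to the left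
perpendicular category `⊥U`. -/
structure IsLeftPerpendicular (A U M : Type u) [Ring A] [AddCommGroup U] [Module A U]
    [AddCommGroup M] [Module A M] : Prop where
  finite : Module.Finite A M
  extVanishes : ∀ i, 0 < i → ExtVanishes A i M U

theorem isLeftPerpendicular_of_projective [Module.Finite A P] [Module.Projective A P] :
    IsLeftPerpendicular A U P :=
  ⟨‹_›, fun _ ↦ extVanishes_of_projective⟩

theorem IsLeftPerpendicular.exists_free_cover [IsNoetherianRing A]
    (hM : IsLeftPerpendicular A U M) :
    ∃ (n : ℕ) (g : (Fin n → A) →ₗ[A] M), Function.Surjective g ∧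
      IsLeftPerpendicular A U (LinearMap.ker g) := by
  have := hM.finite
  obtain ⟨n, g, hg⟩ := Module.Finite.exists_fin' A M
  exact ⟨n, g, hg, inferInstance, fun i hi ↦ (isShortExact_subtype_ker hg).extVanishes_kernel
    (extVanishes_of_projective hi) (hM.extVanishes _ i.succ_pos)⟩

theorem IsLeftPerpendicular.extVanishes_hom [IsNoetherianRing A] [Module.Projective B U]
    (hU : injectiveDimension (ModuleCat.of B U) < ⊤) (hM : IsLeftPerpendicular A U M) {i : ℕ}
    (hi : 0 < i) : ExtVanishes B i (M →ₗ[A] U) U := by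
  obtain ⟨N, hN⟩ := (injectiveDimension_ne_top_iff _).1 hU.ne
  have shift : ∀ (m : ℕ) (M : Type u) [AddCommGroup M] [Module A M], IsLeftPerpendicular A U M →
      ∀ i, 0 < i → N < i + m → ExtVanishes B i (M →ₗ[A] U) U := by
    intro m
    induction m with
    | zero => exact fun M _ _ _ i _ hi ↦ hN.subsingleton _ _ i hi _
    | succ m ih =>
      intro M _ _ hM i hi hiN
      obtain ⟨n, g, hg, hK⟩ := hM.exists_free_cover
      exact ((isShortExact_subtype_ker hg).lcomp (hM.extVanishes 1 one_pos)).extVanishes_kernel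
        (extVanishes_of_projective hi) (ih _ hK (i + 1) i.succ_pos (by omega))
  exact shift N M hM i hi (by omega)

theorem IsLeftPerpendicular.hom [IsNoetherianRing A] [IsNoetherianRing B]
    [Module.Projective B U] [Module.Finite B U]
    (hU : injectiveDimension (ModuleCat.of B U) < ⊤) (hM : IsLeftPerpendicular A U M) :
    IsLeftPerpendicular B U (M →ₗ[A] U) := by
  obtain ⟨n, g, hg, -⟩ := hM.exists_free_cover
  exact ⟨Module.Finite.of_injective _ (LinearMap.lcomp_injective_of_surjective (S := B) g hg),
    fun i ↦ hM.extVanishes_hom hU⟩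

variable [SMulCommClass B A U]

/-- The evaluation map from a module to its bidual with respect to the bimodule `U`. -/
def bidualEval (A B U M : Type u) [Ring A] [Ring B] [AddCommGroup U] [Module A U] [Module B U]
    [SMulCommClass A B U] [SMulCommClass B A U] [AddCommGroup M] [Module A M] :
    M →ₗ[A] (M →ₗ[A] U) →ₗ[B] U :=
  (LinearMap.id : (M →ₗ[A] U) →ₗ[B] M →ₗ[A] U).flip

theorem bidualEval_comp (g : P →ₗ[A] M) :
    bidualEval A B U M ∘ₗ g =
      LinearMap.lcomp A U (LinearMap.lcomp B U g) ∘ₗ bidualEval A B U P :=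
  rfl

theorem bidualEval_self_free_bijective (A : Type u) [Ring A] (n : ℕ) :
    Function.Bijective (bidualEval A Aᵐᵒᵖ A (Fin n → A)) := by
  refine ⟨fun x y h ↦ funext fun i ↦ LinearMap.congr_fun h (LinearMap.proj i), fun ξ ↦ ?_⟩
  have hdual : ∀ φ : (Fin n → A) →ₗ[A] A,
      φ = ∑ i, MulOpposite.op (φ (Pi.single i 1)) • LinearMap.proj i := fun φ ↦
    LinearMap.pi_ext' fun i ↦ LinearMap.ext_ring <| by simp [Pi.single_apply]
  refine ⟨fun i ↦ ξ (LinearMap.proj i), LinearMap.ext fun φ ↦ ?_⟩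
  calc φ (fun i ↦ ξ (LinearMap.proj i))
      = ∑ i, MulOpposite.op (φ (Pi.single i 1)) • ξ (LinearMap.proj i) := by
        conv_lhs => rw [hdual φ]
        simp
    _ = ξ φ := by
        conv_rhs => rw [hdual φ]
        simp only [map_sum, map_smul]

theorem IsLeftPerpendicular.isShortExact_bidual [IsNoetherianRing A] [Module.Projective B U]
    (hU : injectiveDimension (ModuleCat.of B U) < ⊤) (hM : IsLeftPerpendicular A U M)
    (hK : IsLeftPerpendicular A U K) {f : K →ₗ[A] P} {g : P →ₗ[A] M} (h : IsShortExact f g) :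
    IsShortExact (LinearMap.lcomp A U (LinearMap.lcomp B U f))
      (LinearMap.lcomp A U (LinearMap.lcomp B U g)) :=
  (h.lcomp (hM.extVanishes 1 one_pos)).lcomp (hK.extVanishes_hom hU one_pos)

section Reflexivity

variable [IsNoetherianRing A] [Module.Projective B U]
  (hU : injectiveDimension (ModuleCat.of B U) < ⊤)
  (hfree : ∀ n, Function.Bijective (bidualEval A B U (Fin n → A)))

include hU hfree

theorem IsLeftPerpendicular.bidualEval_surjective (hM : IsLeftPerpendicular A U M) :
    Function.Surjective (bidualEval A B U M) := by
  obtain ⟨n, g, hg, hK⟩ := hM.exists_free_cover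
  have hbidual := hM.isShortExact_bidual hU hK (isShortExact_subtype_ker hg)
  refine Function.Surjective.of_comp (g := g) ?_
  rw [← LinearMap.coe_comp, bidualEval_comp]
  exact hbidual.surjective.comp (hfree n).surjective

theorem IsLeftPerpendicular.bidualEval_bijective (hM : IsLeftPerpendicular A U M) :
    Function.Bijective (bidualEval A B U M) := by
  obtain ⟨n, g, hg, hK⟩ := hM.exists_free_cover
  have h := isShortExact_subtype_ker hg
  have hbidual := hM.isShortExact_bidual hU hK h
  refine ⟨?_, hM.bidualEval_surjective hU hfree⟩
  exact AddMonoidHom.injective_of_surjective_of_injective_of_right_exact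
    (LinearMap.ker g).subtype.toAddMonoidHom g.toAddMonoidHom
    (LinearMap.lcomp A U (LinearMap.lcomp B U (LinearMap.ker g).subtype)).toAddMonoidHom
    (LinearMap.lcomp A U (LinearMap.lcomp B U g)).toAddMonoidHom
    (bidualEval A B U (LinearMap.ker g)).toAddMonoidHom
    (bidualEval A B U (Fin n → A)).toAddMonoidHom
    (bidualEval A B U M).toAddMonoidHom rfl rfl h.exact hbidual.exact
    (hK.bidualEval_surjective hU hfree) (hfree n).injective hg

end Reflexivity

/-- `X` is a syzygy of `Y`: the kernel of an epimorphism onto `Y` from a finitely generated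
projective module. Equivalently, `Y` is a cosyzygy of `X`. -/
def IsSyzygyOf (X Y : ModuleCat.{u} A) : Prop :=
  ∃ (P : ModuleCat.{u} A) (f : X →ₗ[A] P) (g : P →ₗ[A] Y), Module.Finite A P ∧
    Module.Projective A P ∧ IsShortExact f g

theorem IsLeftPerpendicular.exists_syzygy [IsNoetherianRing A] (hM : IsLeftPerpendicular A U M) :
    ∃ X : ModuleCat.{u} A, IsLeftPerpendicular A U X ∧ IsSyzygyOf X (ModuleCat.of A M) := by
  obtain ⟨n, g, hg, hK⟩ := hM.exists_free_cover
  exact ⟨ModuleCat.of A (LinearMap.ker g), hK, ModuleCat.of A (Fin n → A), _, g,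
    inferInstanceAs (Module.Finite A (Fin n → A)),
    inferInstanceAs (Module.Projective A (Fin n → A)), isShortExact_subtype_ker hg⟩

/-- Dualising a syzygy of `M* = Hom(M, U)` gives a cosyzygy of `M** ≅ M`. -/
theorem IsLeftPerpendicular.exists_cosyzygy [IsNoetherianRing A] [IsNoetherianRing B]
    [Module.Projective A U] [Module.Finite A U] [Module.Projective B U] [Module.Finite B U]
    (hAU : injectiveDimension (ModuleCat.of A U) < ⊤)
    (hBU : injectiveDimension (ModuleCat.of B U) < ⊤)
    (hfree : ∀ n, Function.Bijective (bidualEval A B U (Fin n → A)))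
    (hM : IsLeftPerpendicular A U M) :
    ∃ Y : ModuleCat.{u} A, IsLeftPerpendicular A U Y ∧ IsSyzygyOf (ModuleCat.of A M) Y := by
  have hdual := hM.hom hBU
  obtain ⟨n, g, hg, hK⟩ := hdual.exists_free_cover
  have hbidual := (isShortExact_subtype_ker hg).lcomp (B := A) (hdual.extVanishes 1 one_pos)
  have heval := hM.bidualEval_bijective hBU hfree
  exact ⟨ModuleCat.of A (LinearMap.ker g →ₗ[B] U), hK.hom hAU,
    ModuleCat.of A ((Fin n → B) →ₗ[B] U), LinearMap.lcomp A U g ∘ₗ bidualEval A B U M, _,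
    inferInstanceAs (Module.Finite A ((Fin n → B) →ₗ[B] U)),
    inferInstanceAs (Module.Projective A ((Fin n → B) →ₗ[B] U)),
    hbidual.injective.comp heval.injective,
    (heval.surjective.comp_exact_iff_exact).2 hbidual.exact, hbidual.surjective⟩

end Duality

section OppositeRing

variable (A : Type u) [Ring A]

/-- The right regular module is free of rank one over the opposite ring. -/
def opSelfEquiv : Aᵐᵒᵖ ≃ₗ[Aᵐᵒᵖ] A :=
  { MulOpposite.opAddEquiv.symm with map_smul' := fun _ _ ↦ rfl }

instance finite_op_self : Module.Finite Aᵐᵒᵖ A :=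
  Module.Finite.equiv (opSelfEquiv A)

instance projective_op_self : Module.Projective Aᵐᵒᵖ A :=
  Module.Projective.of_equiv (opSelfEquiv A)

theorem injectiveDimension_op_self :
    injectiveDimension (ModuleCat.of Aᵐᵒᵖ A) = selfInjectiveDimension Aᵐᵒᵖ :=
  injectiveDimension_eq_of_iso (opSelfEquiv A).symm.toModuleIso

end OppositeRing

section GorensteinProjective

variable {A : Type u} [Ring A] {M N : Type u} [AddCommGroup M] [AddCommGroup N] [Module A M]
  [Module A N]

theorem exists_int_chain {α : Type*} (r : α → α → Prop) (hsucc : ∀ x, ∃ y, r x y)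
    (hpred : ∀ y, ∃ x, r x y) (x : α) : ∃ z : ℤ → α, z 0 = x ∧ ∀ i, r (z i) (z (i + 1)) := by
  choose s hs using hsucc
  choose p hp using hpred
  let z : ℤ → α
    | Int.ofNat k => s^[k] x
    | Int.negSucc k => p^[k + 1] x
  refine ⟨z, rfl, ?_⟩
  rintro (k | _ | k)
  · change r (s^[k] x) (s^[k + 1] x)
    rw [Function.iterate_succ_apply']
    exact hs _
  · exact hp x
  · change r (p^[k + 2] x) (p^[k + 1] x)
    rw [Function.iterate_succ_apply' p (k + 1)]
    exact hp _

theorem isGorensteinProjective_of_chain (Z : ℤ → ModuleCat.{u} A)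
    (hZ : ∀ i, ExtVanishes A 1 (Z i) A) (h : ∀ i, IsSyzygyOf (Z i) (Z (i + 1))) :
    IsGorensteinProjective A (Z 0) := by
  choose P f g hfin hproj hfg using h
  have hexact (i : ℤ) : Function.Exact (f (i + 1) ∘ₗ g i) (f (i + 1 + 1) ∘ₗ g (i + 1)) :=
    (hfg i).surjective.comp_exact_iff_exact.2 <|
      (hfg (i + 1 + 1)).injective.comp_exact_iff_exact.2 (hfg (i + 1)).exact
  refine ⟨⟨P, fun i ↦ f (i + 1) ∘ₗ g i, hfin, hproj, hexact, fun i φ hφ ↦ ?_⟩, ⟨?_⟩⟩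
  · have hφf : φ ∘ₗ f (i + 1) = 0 :=
      (LinearMap.cancel_right (hfg i).surjective).1 hφ
    obtain ⟨φ', rfl⟩ := (hfg (i + 1)).exists_desc φ hφf
    obtain ⟨ψ, rfl⟩ := (hfg (i + 1 + 1)).exists_extension (hZ _) φ'
    exact ⟨ψ, rfl⟩
  · refine (LinearEquiv.ofInjective (f 0) (hfg 0).injective).trans (LinearEquiv.ofEq _ _ ?_)
    exact ((hfg (0 + 1)).injective.comp_exact_iff_exact.2 (hfg 0).exact).linearMap_ker_eq.symm

theorem TotallyAcyclicComplex.extVanishes_range (C : TotallyAcyclicComplex A) (i : ℕ) (j : ℤ) :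
    ExtVanishes A (i + 1) (LinearMap.range (C.d j)) A := by
  have := C.projective
  induction i generalizing j with
  | zero =>
    obtain ⟨k, rfl⟩ : ∃ k, j = k + 1 + 1 := ⟨j - 2, by ring⟩
    refine (isShortExact_range_subtype
      (C.exact (k + 1))).extVanishes_one_of_exists_extension fun φ ↦ ?_
    have hcomp : (C.d (k + 1)).rangeRestrict ∘ₗ C.d k = 0 :=
      LinearMap.ext fun x ↦ Subtype.ext ((C.exact k).apply_apply_eq_zero x)
    obtain ⟨ψ, hψ⟩ := C.dual_exact k (φ ∘ₗ (C.d (k + 1)).rangeRestrict) <| by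
      rw [LinearMap.comp_assoc, hcomp, LinearMap.comp_zero]
    exact ⟨ψ, (LinearMap.cancel_right (C.d (k + 1)).surjective_rangeRestrict).1 hψ⟩
  | succ i ih =>
    obtain ⟨k, rfl⟩ : ∃ k, j = k + 1 := ⟨j - 1, by ring⟩
    exact (isShortExact_range_subtype (C.exact k)).extVanishes_cokernel (ih k)
      (extVanishes_of_projective (i + 1).succ_pos)

theorem TotallyAcyclicComplex.extVanishes_ker (C : TotallyAcyclicComplex A) (j : ℤ) {i : ℕ}
    (hi : 0 < i) : ExtVanishes A i (LinearMap.ker (C.d j)) A := by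
  obtain ⟨i, rfl⟩ := Nat.exists_eq_succ_of_ne_zero hi.ne'
  obtain ⟨k, rfl⟩ : ∃ k, j = k + 1 := ⟨j - 1, by ring⟩
  rw [(C.exact k).linearMap_ker_eq]
  exact C.extVanishes_range i k

theorem IsGorensteinProjective.extVanishes (hM : IsGorensteinProjective A M) {i : ℕ} (hi : 0 < i) :
    ExtVanishes A i M A := by
  obtain ⟨C, ⟨e⟩⟩ := hM
  exact (C.extVanishes_ker 0 hi).congr_left e

theorem HasGorensteinResolution.extVanishes {k : ℕ} (hM : HasGorensteinResolution A k M) {i : ℕ}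
    (hi : k < i) : ExtVanishes A i M A := by
  induction k generalizing M i with
  | zero => exact IsGorensteinProjective.extVanishes hM hi
  | succ k ih =>
    obtain ⟨G, f, hG, hf, hK⟩ := hM
    obtain ⟨i, rfl⟩ := Nat.exists_eq_succ_of_ne_zero (Nat.ne_zero_of_lt hi)
    exact (isShortExact_subtype_ker hf).extVanishes_cokernel (ih hK (by omega))
      (hG.extVanishes i.succ_pos)

/-- An Iwanaga–Gorenstein ring: two-sided Noetherian, with finite injective dimension over itself on
both sides. -/
class IsIwanagaGorenstein (A : Type u) [Ring A] : Prop where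
  left_noetherian : IsNoetherianRing A
  right_noetherian : IsNoetherianRing Aᵐᵒᵖ
  left_finite : selfInjectiveDimension A < ⊤
  right_finite : selfInjectiveDimension Aᵐᵒᵖ < ⊤

attribute [instance] IsIwanagaGorenstein.left_noetherian IsIwanagaGorenstein.right_noetherian

variable [hA : IsIwanagaGorenstein A]

theorem IsIwanagaGorenstein.injectiveDimension_op_lt_top :
    injectiveDimension (ModuleCat.of Aᵐᵒᵖ A) < ⊤ :=
  (injectiveDimension_op_self A).trans_lt hA.right_finite

theorem IsLeftPerpendicular.isGorensteinProjective (hM : IsLeftPerpendicular A A M) :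
    IsGorensteinProjective A M := by
  obtain ⟨z, hz, hsyz⟩ := exists_int_chain
    (fun X Y : {X : ModuleCat.{u} A // IsLeftPerpendicular A A X} ↦ IsSyzygyOf X.1 Y.1)
    (fun X ↦ by
      obtain ⟨Y, hY, h⟩ := X.2.exists_cosyzygy (B := Aᵐᵒᵖ) hA.left_finite
        IsIwanagaGorenstein.injectiveDimension_op_lt_top (bidualEval_self_free_bijective A)
      exact ⟨⟨Y, hY⟩, h⟩)
    (fun Y ↦ by
      obtain ⟨X, hX, h⟩ := Y.2.exists_syzygy
      exact ⟨⟨X, hX⟩, h⟩)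
    ⟨ModuleCat.of A M, hM⟩
  have hz0 := isGorensteinProjective_of_chain (fun i ↦ (z i).1)
    (fun i ↦ (z i).2.extVanishes 1 one_pos) hsyz
  rwa [hz] at hz0

theorem hasGorensteinResolution_of_extVanishes [Module.Finite A M] {k : ℕ}
    (hM : ∀ i, k < i → ExtVanishes A i M A) : HasGorensteinResolution A k M := by
  induction k generalizing M with
  | zero => exact IsLeftPerpendicular.isGorensteinProjective ⟨‹_›, hM⟩
  | succ k ih =>
    obtain ⟨n, g, hg⟩ := Module.Finite.exists_fin' A M
    have hfree : IsGorensteinProjective A (Fin n → A) :=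
      isLeftPerpendicular_of_projective.isGorensteinProjective
    refine ⟨ModuleCat.of A (Fin n → A), g, hfree, hg, ih fun i hi ↦ ?_⟩
    exact (isShortExact_subtype_ker hg).extVanishes_kernel
      (extVanishes_of_projective (Nat.zero_lt_of_lt hi)) (hM (i + 1) (by omega))

theorem gorensteinProjectiveDimension_le_iff [Module.Finite A M] {n : ℕ} :
    gorensteinProjectiveDimension A M ≤ n ↔ ∀ i, n < i → ExtVanishes A i M A := by
  refine ⟨fun h i hi ↦ ?_, fun h ↦ sInf_le ⟨n, rfl, hasGorensteinResolution_of_extVanishes h⟩⟩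
  obtain ⟨_, ⟨k, rfl, hk⟩, hkn⟩ := sInf_lt_iff.1 (h.trans_lt (Nat.cast_lt.2 hi))
  exact hk.extVanishes (Nat.cast_lt.1 hkn)

theorem gorensteinProjectiveDimension_le_of_injective [Module.Finite A N] {n : ℕ}
    (hid : selfInjectiveDimension A ≤ (n + 1 : ℕ)) {f : M →ₗ[A] N} (hf : Function.Injective f)
    (hN : gorensteinProjectiveDimension A N ≤ n) : gorensteinProjectiveDimension A M ≤ n := by
  have := Module.Finite.of_injective f hf
  rw [gorensteinProjectiveDimension_le_iff] at hN ⊢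
  have hid' := (injectiveDimension_le_iff _ _).1 hid
  exact fun i hi ↦ (isShortExact_mkQ_range hf).extVanishes_kernel (hN i hi)
    (hid'.subsingleton _ _ (i + 1) (by omega) _)

/-- `M` embeds into its bidual, which vanishes together with `Hom(M, A)`. -/
theorem subsingleton_of_extVanishes [Module.Finite A M] (hM : ∀ i, ExtVanishes A i M A) :
    Subsingleton M := by
  have heval := IsLeftPerpendicular.bidualEval_bijective (B := Aᵐᵒᵖ) (U := A) (M := M)
    IsIwanagaGorenstein.injectiveDimension_op_lt_top (bidualEval_self_free_bijective A)
    ⟨‹_›, fun i _ ↦ hM i⟩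
  have := extVanishes_zero_iff.1 (hM 0)
  exact heval.injective.subsingleton

end GorensteinProjective

section InjectiveHull

variable {Λ : Type u} [Ring Λ] {Q : Type u} [AddCommGroup Q] [Module Λ Q] {N K E : Submodule Λ Q}

theorem exists_maximal_disjoint (h : Disjoint N K) : ∃ L, K ≤ L ∧ Maximal (Disjoint N) L :=
  zorn_le_nonempty₀ {L | Disjoint N L}
    (fun c hc hchain _ _ ↦
      ⟨sSup c, hchain.directedOn.disjoint_sSup_right.2 fun _ hL ↦ hc hL, fun _ ↦ le_sSup⟩) K h

theorem isEssential_map_mkQ (hK : Maximal (Disjoint N) K) : IsEssential (N.map K.mkQ) := by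
  intro L hL
  have hdisj : Disjoint N (L.comap K.mkQ) := by
    refine Submodule.disjoint_def.2 fun x hxN hxL ↦ Submodule.disjoint_def.1 hK.prop x hxN ?_
    have hx : K.mkQ x ∈ N.map K.mkQ ⊓ L := ⟨Submodule.mem_map_of_mem hxN, hxL⟩
    simpa [hL] using hx
  rw [← Submodule.map_comap_eq_of_surjective K.mkQ_surjective L,
    ← hK.eq_of_le hdisj (K.le_comap_mkQ L), Submodule.mkQ_map_self]

theorem isEssential_comap_subtype (hK : Maximal (Disjoint N) K) (hE : Disjoint E K)
    (hNE : N ≤ E) : IsEssential (N.comap E.subtype) := by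
  intro L hL
  have hle : L.map E.subtype ≤ E := Submodule.map_subtype_le E L
  have hNL : Disjoint N (L.map E.subtype) := by
    rw [disjoint_iff, inf_comm, Submodule.map_inf_eq_map_inf_comap, inf_comm, hL, Submodule.map_bot]
  have hmax := hNL.disjoint_sup_right_of_disjoint_sup_left (hE.mono_left (sup_le hNE hle))
  have hLK : L.map E.subtype ≤ K := le_sup_left.trans (hK.le_of_ge hmax le_sup_right)
  exact Submodule.map_injective_of_injective E.subtype_injective <|
    (le_bot_iff.1 (hE hle hLK)).trans (Submodule.map_bot _).symm

theorem injective_of_retract {M : Type u} [AddCommGroup M] [Module Λ M] [Module.Injective Λ Q]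
    (s : M →ₗ[Λ] Q) (r : Q →ₗ[Λ] M) (h : ∀ x, r (s x) = x) : Module.Injective Λ M where
  out X Y _ _ _ _ f hf g := by
    obtain ⟨k, hk⟩ := Module.Injective.out f hf (s ∘ₗ g)
    exact ⟨r ∘ₗ k, fun x ↦ by simp [hk, h]⟩

/-- Extending `E ≤ Q` along the essential embedding `E → Q ⧸ K` gives `h : Q ⧸ K → Q`; the image of
`h` is disjoint from `K`, hence equals `E`, so `h` exhibits `E` as a retract of `Q`. -/
theorem injective_of_maximal_disjoint [Module.Injective Λ Q] (hK : Maximal (Disjoint E) K)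
    (hE : Maximal (Disjoint K) E) : Module.Injective Λ E := by
  have hj : Function.Injective (K.mkQ ∘ₗ E.subtype) := by
    rw [← LinearMap.ker_eq_bot, LinearMap.ker_comp, Submodule.ker_mkQ]
    exact Submodule.disjoint_iff_comap_eq_bot.1 hK.prop
  obtain ⟨h, hh⟩ := Module.Injective.out _ hj E.subtype
  have hcomap : K.comap h = ⊥ := by
    refine isEssential_map_mkQ hK _ (disjoint_iff.1 <| Submodule.disjoint_def.2 ?_)
    rintro _ ⟨x, hx, rfl⟩ hxK
    have hhx : h (K.mkQ x) = x := hh ⟨x, hx⟩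
    rw [Submodule.mem_comap, hhx] at hxK
    rw [Submodule.disjoint_def.1 hK.prop x hx hxK, map_zero]
  have hdisj : Disjoint K (LinearMap.range h) := by
    rw [disjoint_comm, disjoint_iff, ← Submodule.map_comap_eq, hcomap, Submodule.map_bot]
  have hrange : LinearMap.range h ≤ E := hE.le_of_ge hdisj fun x hx ↦ ⟨_, hh ⟨x, hx⟩⟩
  exact injective_of_retract E.subtype
    ((h ∘ₗ K.mkQ).codRestrict E fun x ↦ hrange (LinearMap.mem_range_self h _))
    fun x ↦ Subtype.ext (hh x)

theorem exists_injective_hull (M : Type u) [AddCommGroup M] [Module Λ M] :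
    ∃ (E : ModuleCat.{u} Λ) (ι : M →ₗ[Λ] E), Module.Injective Λ E ∧ Function.Injective ι ∧
      IsEssential (LinearMap.range ι) := by
  obtain ⟨⟨Q, _, f, _⟩⟩ := EnoughInjectives.presentation (ModuleCat.of Λ M)
  have := Module.injective_module_of_injective_object Λ Q
  obtain ⟨K, -, hK⟩ := exists_maximal_disjoint (disjoint_bot_right (a := LinearMap.range f.hom))
  obtain ⟨E, hfE, hE⟩ := exists_maximal_disjoint hK.prop.symm
  have hKE : Maximal (Disjoint E) K := ⟨hE.prop.symm, fun L hL ↦ hK.2 (hL.mono_left hfE)⟩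
  have hinj : Function.Injective f.hom := (ModuleCat.mono_iff_injective f).1 inferInstance
  refine ⟨ModuleCat.of Λ E, f.hom.codRestrict E fun x ↦ hfE ⟨x, rfl⟩,
    injective_of_maximal_disjoint hKE hE, ?_, ?_⟩
  · exact (LinearMap.injective_codRestrict_iff _).2 hinj
  · rw [LinearMap.range_codRestrict]
    exact isEssential_comap_subtype hK hE.prop.symm hfE

end InjectiveHull

section FiniteGeneration

variable {Λ : Type u} [Ring Λ] {E : Type u} [AddCommGroup E] [Module Λ E] {N : Submodule Λ E}

theorem socle_le_of_isEssential (hN : IsEssential N) : socle Λ E ≤ N := by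
  refine sSup_le fun S hS ↦ ?_
  have hatom : IsAtom S := isSimpleModule_iff_isAtom.1 hS
  rcases hatom.le_iff.1 (inf_le_right : N ⊓ S ≤ S) with h | h
  · exact absurd (hN S h) hatom.1
  · exact inf_eq_right.1 h

theorem le_socle_of_isSemisimpleModule [IsSemisimpleModule Λ N] : N ≤ socle Λ E := by
  rw [← N.range_subtype, LinearMap.range_eq_map, ← IsSemisimpleModule.sSup_simples_eq_top Λ N,
    Submodule.map_le_iff_le_comap]
  refine sSup_le fun S (hS : IsSimpleModule Λ S) ↦ Submodule.map_le_iff_le_comap.1 (le_sSup ?_)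
  exact IsSimpleModule.congr (S.equivMapOfInjective N.subtype N.subtype_injective).symm

theorem mem_socle_of_jacobson_smul_eq_zero [IsSemiprimaryRing Λ] {x : E}
    (hx : ∀ r ∈ Ring.jacobson Λ, r • x = 0) : x ∈ socle Λ E := by
  have htors : Module.IsTorsionBySet Λ (Submodule.span Λ {x}) (Ring.jacobson Λ) := by
    rintro ⟨y, hy⟩ ⟨r, hr⟩
    obtain ⟨a, rfl⟩ := Submodule.mem_span_singleton.1 hy
    refine Subtype.ext ?_
    change r • a • x = 0
    rw [smul_smul]
    exact hx _ (Ideal.mul_mem_right _ _ hr)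
  have : IsSemisimpleModule Λ (Submodule.span Λ {x}) := by
    let _ := htors.module
    exact htors.isSemisimpleModule_iff.1 inferInstance
  exact le_socle_of_isSemisimpleModule (Submodule.mem_span_singleton_self x)

section Annihilated

variable (R : Type v) [CommRing R] [Algebra R Λ] (E) [Module R E] [IsScalarTower R Λ E]

/-- The elements of a module annihilated by a left ideal. -/
def annihilatedBy (I : Ideal Λ) : Submodule R E where
  carrier := {x | ∀ r ∈ I, r • x = 0}
  add_mem' hx hy r hr := by rw [smul_add, hx r hr, hy r hr, add_zero]
  zero_mem' r _ := smul_zero r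
  smul_mem' c x hx r hr := by
    rw [← algebraMap_smul Λ c x, smul_smul, ← Algebra.commutes, ← smul_smul, hx r hr, smul_zero]

/-- Multiplication by the elements of `J` maps the elements annihilated by `I * J` to those
annihilated by `I`. -/
def annihilatedByMul (I J : Ideal Λ) :
    annihilatedBy E R (I * J) →ₗ[R] J.restrictScalars R →ₗ[R] annihilatedBy E R I :=
  LinearMap.mk₂ R (fun x s ↦ ⟨(s : Λ) • (x : E), fun r hr ↦ by
      rw [smul_smul]; exact x.2 _ (Ideal.mul_mem_mul hr s.2)⟩)
    (fun _ _ _ ↦ Subtype.ext (smul_add _ _ _))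
    (fun c x s ↦ Subtype.ext (smul_comm (s : Λ) c (x : E)))
    (fun _ _ _ ↦ Subtype.ext (add_smul _ _ _))
    (fun c x s ↦ Subtype.ext (smul_assoc c (s : Λ) (x : E)))

variable {E R}

theorem annihilatedBy_top : annihilatedBy E R (⊤ : Ideal Λ) = ⊥ :=
  eq_bot_iff.2 fun x hx ↦ by simpa using hx 1 trivial

theorem annihilatedBy_bot : annihilatedBy E R (⊥ : Ideal Λ) = ⊤ :=
  eq_top_iff.2 fun x _ r hr ↦ by rw [(Submodule.mem_bot Λ).1 hr, zero_smul]

variable [IsNoetherianRing R] [Module.Finite R Λ]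

theorem isNoetherian_annihilatedBy_mul {I J : Ideal Λ} (hI : IsNoetherian R (annihilatedBy E R I))
    (hJ : IsNoetherian R (annihilatedBy E R J)) : IsNoetherian R (annihilatedBy E R (I * J)) := by
  have hle : annihilatedBy E R J ≤ annihilatedBy E R (I * J) :=
    fun x hx r hr ↦ hx r (Ideal.mul_le_right hr)
  refine isNoetherian_of_range_eq_ker (Submodule.inclusion hle) (annihilatedByMul E R I J) ?_
  ext x
  rw [Submodule.range_inclusion, LinearMap.mem_ker]
  exact ⟨fun hx ↦ LinearMap.ext fun s ↦ Subtype.ext (hx s s.2),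
    fun hx r hr ↦ congrArg Subtype.val (LinearMap.congr_fun hx ⟨r, hr⟩)⟩

theorem isNoetherian_annihilatedBy_pow {I : Ideal Λ} (hI : IsNoetherian R (annihilatedBy E R I))
    (k : ℕ) : IsNoetherian R (annihilatedBy E R (I ^ k)) := by
  induction k with
  | zero =>
    rw [Submodule.pow_zero, Ideal.one_eq_top, annihilatedBy_top]
    infer_instance
  | succ k ih =>
    rw [Submodule.pow_succ]
    exact isNoetherian_annihilatedBy_mul ih hI

end Annihilated

variable (R : Type v) [CommRing R] [IsArtinianRing R] [Algebra R Λ] [Module.Finite R Λ]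

include R in
theorem finite_of_isEssential (hfin : Module.Finite Λ N) (hN : IsEssential N) :
    Module.Finite Λ E := by
  have : IsArtinianRing Λ := IsArtinianRing.of_finite R Λ
  let _ : Module R E := Module.compHom E (algebraMap R Λ)
  have : IsScalarTower R Λ E := ⟨fun c a x ↦ by rw [Algebra.smul_def, mul_smul]; rfl⟩
  have : Module.Finite R N := Module.Finite.trans Λ N
  have hjac : annihilatedBy E R (Ring.jacobson Λ) ≤ N.restrictScalars R := fun x hx ↦
    socle_le_of_isEssential hN (mem_socle_of_jacobson_smul_eq_zero hx)
  have : IsNoetherian R (N.restrictScalars R) := inferInstanceAs (IsNoetherian R N)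
  obtain ⟨m, hm⟩ := IsSemiprimaryRing.isNilpotent (R := Λ)
  have hpow := isNoetherian_annihilatedBy_pow (isNoetherian_of_le hjac) m
  rw [hm, Submodule.zero_eq_bot, annihilatedBy_bot, isNoetherian_top_iff] at hpow
  exact Module.Finite.of_restrictScalars_finite R Λ E

/-- A short exact sequence `0 → X → I → Y → 0` in which `I` is a finitely generated injective
envelope of `X`. -/
def IsMinimalCosyzygyOf (Y X : ModuleCat.{u} Λ) : Prop :=
  ∃ (I : ModuleCat.{u} Λ) (ι : X →ₗ[Λ] I) (g : I →ₗ[Λ] Y), Module.Finite Λ I ∧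
    Module.Injective Λ I ∧ IsEssential (LinearMap.range ι) ∧ IsShortExact ι g

include R in
theorem exists_isMinimalCosyzygyOf (X : ModuleCat.{u} Λ) [Module.Finite Λ X] :
    ∃ Y : ModuleCat.{u} Λ, Module.Finite Λ Y ∧ IsMinimalCosyzygyOf Y X := by
  obtain ⟨E, ι, hE, hι, hess⟩ := exists_injective_hull (Λ := Λ) X
  have : Module.Finite Λ E := finite_of_isEssential R (Module.Finite.range ι) hess
  exact ⟨ModuleCat.of Λ (E ⧸ LinearMap.range ι),
    inferInstanceAs (Module.Finite Λ (E ⧸ LinearMap.range ι)), E, ι, _, this, hE, hess,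
    isShortExact_mkQ_range hι⟩

theorem minimalInjectiveCoresolution_of_chain (Z : ℕ → ModuleCat.{u} Λ)
    (h : ∀ k, IsMinimalCosyzygyOf (Z (k + 1)) (Z k)) :
    Nonempty (MinimalInjectiveCoresolution Λ (Z 0)) := by
  choose I ι g hfin hinj hess hse using h
  refine ⟨⟨I, ι 0, fun k ↦ ι (k + 1) ∘ₗ g k, hfin, hinj, (hse 0).injective,
    (hse 1).injective.comp_exact_iff_exact.2 (hse 0).exact, fun k ↦ ?_, hess 0, fun k ↦ ?_⟩⟩
  · exact (hse k).surjective.comp_exact_iff_exact.2 <|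
      (hse (k + 1 + 1)).injective.comp_exact_iff_exact.2 (hse (k + 1)).exact
  · rw [LinearMap.range_comp_of_range_eq_top _ (LinearMap.range_eq_top.2 (hse k).surjective)]
    exact hess (k + 1)

include R in
theorem exists_minimalInjectiveCoresolution (M : Type u) [AddCommGroup M] [Module Λ M]
    [Module.Finite Λ M] : Nonempty (MinimalInjectiveCoresolution Λ M) := by
  have hstep : ∀ X : {X : ModuleCat.{u} Λ // Module.Finite Λ X},
      ∃ Y : {X : ModuleCat.{u} Λ // Module.Finite Λ X}, IsMinimalCosyzygyOf Y.1 X.1 := fun X ↦ by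
    have := X.2
    obtain ⟨Y, hY, h⟩ := exists_isMinimalCosyzygyOf R X.1
    exact ⟨⟨Y, hY⟩, h⟩
  choose s hs using hstep
  refine minimalInjectiveCoresolution_of_chain
    (fun k ↦ (s^[k] ⟨ModuleCat.of Λ M, ‹_›⟩).1) fun k ↦ ?_
  rw [Function.iterate_succ_apply']
  exact hs _

end FiniteGeneration

section MinimalAuslanderGorenstein

variable {Λ : Type u} [Ring Λ]

namespace MinimalInjectiveCoresolution

variable {M X N : Type u} [AddCommGroup M] [Module Λ M] [AddCommGroup X] [Module Λ X]
  [AddCommGroup N] [Module Λ N]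

/-- The minimal injective coresolution of the first cosyzygy of `M`, obtained by deleting the
injective envelope of `M`. -/
def tail (C : MinimalInjectiveCoresolution Λ M) :
    MinimalInjectiveCoresolution Λ (LinearMap.range (C.d 0)) where
  I j := C.I (j + 1)
  ε := (LinearMap.range (C.d 0)).subtype
  d j := C.d (j + 1)
  finite j := C.finite (j + 1)
  injective j := C.injective (j + 1)
  ε_injective := Submodule.subtype_injective _
  exact_zero := exact_range_subtype (C.exact_succ 0)
  exact_succ j := C.exact_succ (j + 1)
  essential_ε := by rw [Submodule.range_subtype]; exact C.essential_d 0
  essential_d j := C.essential_d (j + 1)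

theorem extVanishes (C : MinimalInjectiveCoresolution Λ M) {i : ℕ}
    (h : ∀ l ≤ i, Subsingleton (X →ₗ[Λ] C.I l)) : ExtVanishes Λ i X M := by
  induction i generalizing M with
  | zero =>
    have := h 0 le_rfl
    exact extVanishes_zero_iff.2 C.ε_injective.injective_linearMapComp_left.subsingleton
  | succ i ih =>
    have := C.injective 0
    exact (isShortExact_rangeRestrict C.ε_injective C.exact_zero).extVanishes_into_kernel
      (ih C.tail fun l hl ↦ h (l + 1) (by omega)) (extVanishes_of_injective i.succ_pos)

theorem extVanishes_ker_of_projective [Module.Projective Λ M]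
    (C : MinimalInjectiveCoresolution Λ M) {j i : ℕ} (h : ∀ l < j, Module.Projective Λ (C.I l))
    (hi : j < i) : ExtVanishes Λ i (LinearMap.ker (C.d j)) N := by
  induction j generalizing i with
  | zero =>
    rw [C.exact_zero.linearMap_ker_eq]
    exact (extVanishes_of_projective hi).congr_left (LinearEquiv.ofInjective _ C.ε_injective).symm
  | succ j ih =>
    obtain ⟨i, rfl⟩ := Nat.exists_eq_succ_of_ne_zero (Nat.ne_zero_of_lt hi)
    have := h j j.lt_succ_self
    rw [(C.exact_succ j).linearMap_ker_eq]
    exact (isShortExact_rangeRestrict (Submodule.subtype_injective _)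
      (LinearMap.exact_subtype_ker_map (C.d j))).extVanishes_cokernel
      (ih (fun l hl ↦ h l (by omega)) (by omega)) (extVanishes_of_projective i.succ_pos)

theorem socle_le_ker (C : MinimalInjectiveCoresolution Λ M) (j : ℕ) :
    socle Λ (C.I j) ≤ LinearMap.ker (C.d j) := by
  cases j with
  | zero => exact C.exact_zero.linearMap_ker_eq ▸ socle_le_of_isEssential C.essential_ε
  | succ j => exact (C.exact_succ j).linearMap_ker_eq ▸ socle_le_of_isEssential (C.essential_d j)

end MinimalInjectiveCoresolution

theorem le_dominantDimension_iff {n : ℕ} :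
    ((n + 1 : ℕ) : ℕ∞) ≤ dominantDimension Λ ↔ ∃ C : MinimalInjectiveCoresolution Λ Λ,
      ∀ j ≤ n, Module.Projective Λ (C.I j) := by
  constructor
  · intro h
    obtain ⟨t, ⟨C, hC⟩, ht⟩ := lt_sSup_iff.1 ((Nat.cast_lt.2 n.lt_succ_self).trans_le h)
    exact ⟨C, fun j hj ↦ hC j ((Nat.cast_le.2 hj).trans_lt ht)⟩
  · rintro ⟨C, hC⟩
    exact le_sSup ⟨C, fun j hj ↦ hC j (Nat.lt_succ_iff.1 (Nat.cast_lt.1 hj))⟩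

theorem injective_prod {M N : Type u} [AddCommGroup M] [AddCommGroup N] [Module Λ M] [Module Λ N]
    [Module.Injective Λ M] [Module.Injective Λ N] : Module.Injective Λ (M × N) where
  out X Y _ _ _ _ f hf g := by
    obtain ⟨h₁, H₁⟩ := Module.Injective.out f hf (LinearMap.fst Λ M N ∘ₗ g)
    obtain ⟨h₂, H₂⟩ := Module.Injective.out f hf (LinearMap.snd Λ M N ∘ₗ g)
    exact ⟨h₁.prod h₂, fun x ↦ Prod.ext (H₁ x) (H₂ x)⟩

/-- A map to a projective-injective module with minimal kernel is injective: a simple submodule of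
the kernel could be removed by adding one more map. -/
theorem projective_of_forall_isSimpleModule {I : Type u} [AddCommGroup I] [Module Λ I]
    [IsArtinian Λ I] [Module.Injective Λ I]
    (h : ∀ S : Submodule Λ I, IsSimpleModule Λ S → ∃ W : ModuleCat.{u} Λ,
      Module.Projective Λ W ∧ Module.Injective Λ W ∧ Nontrivial (S →ₗ[Λ] W)) :
    Module.Projective Λ I := by
  obtain ⟨K, ⟨W, hP, hI, f, rfl⟩, hmin⟩ := IsArtinian.set_has_minimal
    {K : Submodule Λ I | ∃ W : ModuleCat.{u} Λ, Module.Projective Λ W ∧ Module.Injective Λ W ∧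
      ∃ f : I →ₗ[Λ] W, K = LinearMap.ker f}
    ⟨⊤, ModuleCat.of Λ PUnit.{u + 1}, inferInstanceAs (Module.Projective Λ PUnit.{u + 1}),
      ⟨fun _ _ _ _ _ _ _ _ _ ↦ ⟨0, fun _ ↦ rfl⟩⟩, 0, LinearMap.ker_zero.symm⟩
  have hf : LinearMap.ker f = ⊥ := by
    by_contra hker
    obtain ⟨S, hS, hSf⟩ := (eq_bot_or_exists_atom_le (LinearMap.ker f)).resolve_left hker
    obtain ⟨W', _, _, _⟩ := h S (isSimpleModule_iff_isAtom.2 hS)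
    obtain ⟨g₀, hg₀⟩ := exists_ne (0 : S →ₗ[Λ] W')
    obtain ⟨g, hg⟩ := Module.Injective.out S.subtype S.subtype_injective g₀
    have hSg : ¬S ≤ LinearMap.ker g := fun hle ↦
      hg₀ <| LinearMap.ext fun x ↦ (hg x).symm.trans (hle x.2)
    have hlt : LinearMap.ker (f.prod g) < LinearMap.ker f := by
      rw [LinearMap.ker_prod, inf_lt_left]
      exact fun hle ↦ hSg (hSf.trans hle)
    exact hmin _ ⟨ModuleCat.of Λ (W × W'), inferInstanceAs (Module.Projective Λ (W × W')),
      injective_prod, f.prod g, rfl⟩ hlt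
  obtain ⟨r, hr⟩ := Module.Injective.out f (LinearMap.ker_eq_bot.1 hf) LinearMap.id
  exact Module.Projective.of_split f r (LinearMap.ext hr)

variable [IsIwanagaGorenstein Λ] {n : ℕ}

theorem MinimalInjectiveCoresolution.exists_nontrivial_hom (C : MinimalInjectiveCoresolution Λ Λ)
    {X : Type u} [AddCommGroup X] [Module Λ X] [Module.Finite Λ X] [Nontrivial X]
    (hX : gorensteinProjectiveDimension Λ X ≤ n) : ∃ l ≤ n, Nontrivial (X →ₗ[Λ] C.I l) := by
  by_contra! hzero
  refine not_subsingleton X (subsingleton_of_extVanishes (A := Λ) fun i ↦ ?_)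
  rcases le_or_gt i n with hi | hi
  · exact C.extVanishes fun l hl ↦ hzero l (hl.trans hi)
  · exact gorensteinProjectiveDimension_le_iff.1 hX i hi

theorem prinj_le_injWithSocleGpdLE (hid : selfInjectiveDimension Λ ≤ (n + 1 : ℕ)) :
    prinj Λ ≤ injWithSocleGpdLE n Λ := by
  rintro I ⟨hfin, hproj, hinj⟩
  have hI : gorensteinProjectiveDimension Λ I ≤ n := gorensteinProjectiveDimension_le_iff.2
    fun i hi ↦ extVanishes_of_projective (Nat.zero_lt_of_lt hi)
  exact ⟨hfin, hinj, gorensteinProjectiveDimension_le_of_injective hid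
    (Submodule.subtype_injective (socle Λ I)) hI⟩

theorem injWithSocleGpdLE_le_prinj [IsArtinianRing Λ]
    (hid : selfInjectiveDimension Λ ≤ (n + 1 : ℕ)) (C : MinimalInjectiveCoresolution Λ Λ)
    (hC : ∀ j ≤ n, Module.Projective Λ (C.I j)) : injWithSocleGpdLE n Λ ≤ prinj Λ := by
  rintro I ⟨hfin, hinj, hsoc⟩
  refine ⟨hfin, projective_of_forall_isSimpleModule fun S hS ↦ ?_, hinj⟩
  have hle : S ≤ socle Λ I := le_sSup hS
  have := IsSimpleModule.nontrivial Λ S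
  obtain ⟨l, hl, hlS⟩ := C.exists_nontrivial_hom <|
    gorensteinProjectiveDimension_le_of_injective hid (Submodule.inclusion_injective hle) hsoc
  exact ⟨C.I l, hC l hl, C.injective l, hlS⟩

/-- If `I 0, …, I (j - 1)` are projective, then `d j` has kernel of Gorenstein projective dimension
at most `j`, and this kernel contains the socle of `I j`. -/
theorem projective_of_injWithSocleGpdLE_le_prinj (hid : selfInjectiveDimension Λ ≤ (n + 1 : ℕ))
    (h : injWithSocleGpdLE n Λ ≤ prinj Λ) (C : MinimalInjectiveCoresolution Λ Λ) {j : ℕ}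
    (hj : j ≤ n) : Module.Projective Λ (C.I j) := by
  induction j using Nat.strong_induction_on with
  | _ j ih =>
    have := C.finite j
    have hker : gorensteinProjectiveDimension Λ (LinearMap.ker (C.d j)) ≤ n :=
      gorensteinProjectiveDimension_le_iff.2 fun i hi ↦ C.extVanishes_ker_of_projective
        (fun l hl ↦ ih l hl (hl.le.trans hj)) (hj.trans_lt hi)
    have hsoc := gorensteinProjectiveDimension_le_of_injective hid
      (Submodule.inclusion_injective (C.socle_le_ker j)) hker
    exact (h (C.I j) ⟨C.finite j, C.injective j, hsoc⟩).2.1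

end MinimalAuslanderGorenstein

end AuslanderGorenstein

open AuslanderGorenstein in
theorem theorem4p1_general {Λ : Type u} [Ring Λ] [IsArtinianRing Λ] [IsNoetherianRing Λᵐᵒᵖ] (n : ℕ)
    (hleft : selfInjectiveDimension Λ ≤ (n + 1 : ℕ)) (hright : selfInjectiveDimension Λᵐᵒᵖ < ⊤)
    (hres : Nonempty (MinimalInjectiveCoresolution Λ Λ)) :
    IsMinimalAuslanderGorenstein n Λ ↔ prinj Λ = injWithSocleGpdLE n Λ := by
  have : IsIwanagaGorenstein Λ :=
    ⟨inferInstance, inferInstance, hleft.trans_lt (WithBot.coe_lt_coe.2 (ENat.natCast_lt_top _)),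
      hright⟩
  constructor
  · intro h
    obtain ⟨C, hC⟩ := le_dominantDimension_iff.1 h.le_dominantDimension
    exact le_antisymm (prinj_le_injWithSocleGpdLE hleft) (injWithSocleGpdLE_le_prinj hleft C hC)
  · intro h
    obtain ⟨C⟩ := hres
    exact ⟨hleft, le_dominantDimension_iff.2
      ⟨C, fun _ ↦ projective_of_injWithSocleGpdLE_le_prinj hleft h.ge C⟩⟩

theorem theorem4p1 {R : Type v} [CommRing R] [IsArtinianRing R]
    {Λ : Type u} [Ring Λ] [Algebra R Λ] [Module.Finite R Λ] (n : ℕ)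
    (hΛ : AuslanderGorenstein.IsGorensteinOfDimension (n + 1) Λ) :
    AuslanderGorenstein.IsMinimalAuslanderGorenstein n Λ ↔
      AuslanderGorenstein.prinj Λ = AuslanderGorenstein.injWithSocleGpdLE n Λ := by
  have := IsArtinianRing.of_finite R Λ
  have := IsArtinianRing.of_finite R Λᵐᵒᵖ
  exact theorem4p1_general n hΛ.left_eq.le hΛ.right_finite
    (AuslanderGorenstein.exists_minimalInjectiveCoresolution R Λ)
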